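/- Theorem 2 (rigidity). Let $m \geq 3$ and let $(\mathbb{H}, g_{\mathbb{H}})$ be $m$-dimensional hyperbolic space, realised as the open unit ball in $\mathbb{R}^m$ with the Poincaré metric $g_{\mathbb{H}} = \frac{4}{(1-|x|^2)^2}|dx|^2$, of constant sectional curvature $-1$. Let $0 < T \leq \infty$. A Yamabe flow on $\mathbb{H}$ with initial metric $g_0$ is a family $(g(t))_{t\in[0,T)}$ of Riemannian metrics on $\mathbb{H}$, of class $C^{2;1}$ on $\mathbb{H}\times[0,T)$ (the components $g_{ij}$, their spatial derivatives up to order two and their first time derivative exist and are jointly continuous, time $0$ included), with $$\frac{\partial}{\partial t} g(t) = -R_{g(t)}\, g(t) \quad \text{for all } t \in [0,T), \qquad g(0) = g_0,$$ where $R_g$ denotes the scalar curvature of $g$. Neither completeness, nor curvature bounds, nor symmetry, nor conformality to $g_{\mathbb{H}}$ is assumed. Then the Yamabe flow on $\mathbb{H}$ with $g(0) = g_{\mathbb{H}}$ is uniquely given by $$g(t) = \bigl(m(m-1)t + 1\bigr)\, g_{\mathbb{H}} \quad \text{for all } t \in [0,T),$$ that is, a family $(g(t))_{t\in[0,T)}$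 is a Yamabe flow on $\mathbb{H}$ with $g(0) = g_{\mathbb{H}}$ if and only if it is this one. -/

import Mathlib

/-- A field of `m × m` matrices on `ℝᵐ`: the components `g_{ij}(x)` of a (0,2)-tensor field in
standard coordinates. Only the values on the domain under consideration matter. -/
abbrev TensorField (m : ℕ) : Type :=
  EuclideanSpace ℝ (Fin m) → Matrix (Fin m) (Fin m) ℝ

/-- The partial derivative `∂f/∂xₖ` at `x`. -/
noncomputable def partialDeriv {m : ℕ} (k : Fin m) (f : EuclideanSpace ℝ (Fin m) → ℝ)
    (x : EuclideanSpace ℝ (Fin m)) : ℝ :=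
  fderiv ℝ f x (EuclideanSpace.single k 1)

/-- The Christoffel symbols
`Γᵏᵢⱼ = ½ ∑ₗ gᵏˡ (∂ᵢ gⱼₗ + ∂ⱼ gᵢₗ - ∂ₗ gᵢⱼ)` of the Levi-Civita connection of `g`. -/
noncomputable def christoffel {m : ℕ} (g : TensorField m) (k i j : Fin m)
    (x : EuclideanSpace ℝ (Fin m)) : ℝ :=
  (1 / 2) * ∑ l, (g x)⁻¹ k l *
    (partialDeriv i (fun y => g y j l) x + partialDeriv j (fun y => g y i l) x
      - partialDeriv l (fun y => g y i j) x)

/-- The components `Rˡₖᵢⱼ` of the Riemann curvature tensor, given by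
`R(∂ᵢ, ∂ⱼ) ∂ₖ = ∑ₗ Rˡₖᵢⱼ ∂ₗ`, where `R(X, Y) = ∇_X ∇_Y - ∇_Y ∇_X - ∇_[X, Y]`. -/
noncomputable def riemannTensor {m : ℕ} (g : TensorField m) (l k i j : Fin m)
    (x : EuclideanSpace ℝ (Fin m)) : ℝ :=
  partialDeriv i (christoffel g l j k) x - partialDeriv j (christoffel g l i k) x
    + ∑ p, (christoffel g l i p x * christoffel g p j k x
        - christoffel g l j p x * christoffel g p i k x)

/-- The Ricci tensor `Ric_{kj} = ∑ₗ Rˡₖₗⱼ`. -/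
noncomputable def ricciTensor {m : ℕ} (g : TensorField m) (k j : Fin m)
    (x : EuclideanSpace ℝ (Fin m)) : ℝ :=
  ∑ l, riemannTensor g l k l j x

/-- The scalar curvature `R_g = ∑ gᵏʲ Ric_{kj}`. -/
noncomputable def scalarCurvature {m : ℕ} (g : TensorField m)
    (x : EuclideanSpace ℝ (Fin m)) : ℝ :=
  ∑ k, ∑ j, (g x)⁻¹ k j * ricciTensor g k j x

/-- The time interval `[0, T[`, where `T = ∞` is allowed. -/
def timeInterval (T : EReal) : Set ℝ := {t : ℝ | 0 ≤ t ∧ (t : EReal) < T}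

/-- The family `(g(t))`, `t ∈ [0, T[`, of Riemannian metrics on the open set `Ω ⊆ ℝᵐ` is a
Yamabe flow with initial metric `g₀`: it is a classical solution, of class `C^{2;1}` on
`Ω × [0, T[` (time 0 included), of `∂g/∂t = -R_g g`, `g(0) = g₀`.
No completeness or bound is required. -/
structure IsYamabeFlow {m : ℕ} (Ω : Set (EuclideanSpace ℝ (Fin m))) (g₀ : TensorField m)
    (T : EReal) (g : ℝ → TensorField m) : Prop where
  /-- Each `g(t)` is symmetric and positive definite at each point. -/
  posDef : ∀ t ∈ timeInterval T, ∀ x ∈ Ω, (g t x).PosDef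
  /-- Each `g(t)` is twice continuously differentiable in space. -/
  contDiffOn : ∀ t ∈ timeInterval T, ∀ i j, ContDiffOn ℝ 2 (fun x => g t x i j) Ω
  /-- The components are jointly continuous in `(t, x)`. -/
  continuousOn : ∀ i j,
    ContinuousOn (fun p : ℝ × EuclideanSpace ℝ (Fin m) => g p.1 p.2 i j) (timeInterval T ×ˢ Ω)
  /-- So are their first spatial derivatives. -/
  continuousOn_partial : ∀ i j k,
    ContinuousOn (fun p : ℝ × EuclideanSpace ℝ (Fin m) =>
      partialDeriv k (fun x => g p.1 x i j) p.2) (timeInterval T ×ˢ Ω)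
  /-- So are their second spatial derivatives. -/
  continuousOn_partial_partial : ∀ i j k l,
    ContinuousOn (fun p : ℝ × EuclideanSpace ℝ (Fin m) =>
      partialDeriv l (partialDeriv k (fun x => g p.1 x i j)) p.2) (timeInterval T ×ˢ Ω)
  /-- The evolution equation, with a one-sided time derivative at `t = 0`. By the previous
  fields its right-hand side, hence the time derivative, is jointly continuous. -/
  evolution : ∀ t ∈ timeInterval T, ∀ x ∈ Ω, ∀ i j,
    HasDerivWithinAt (fun s => g s x i j) (-scalarCurvature (g t) x * g t x i j)
      (timeInterval T) t
  /-- The initial condition. -/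
  initial : ∀ x ∈ Ω, g 0 x = g₀ x

/-- The domain of the Poincaré ball model of `m`-dimensional hyperbolic space:
the open unit ball of `ℝᵐ`. -/
def hyperbolicBall (m : ℕ) : Set (EuclideanSpace ℝ (Fin m)) := Metric.ball 0 1

/-- The hyperbolic metric (sectional curvature `-1`) in the Poincaré ball model,
`g_ℍ = 4 |dx|² / (1 - |x|²)²`. -/
noncomputable def hyperbolicMetric (m : ℕ) : TensorField m :=
  fun x => (4 / (1 - ‖x‖ ^ 2) ^ 2) • (1 : Matrix (Fin m) (Fin m) ℝ)

/-! The flow equation multiplies all components of `g` at a point by one common factor, so their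
ratios are constant in time and `g = f |dx|²` throughout (`IsYamabeFlow.eq_smul_one`). By
`scalarCurvature_conformal` the flow becomes the scalar equation `∂f/∂t = yamabeOperator f`, and
everything rests on comparison at a first touching time (`exists_first_touching`,
`yamabeOperator_le_of_touching`). As nothing is known about `f` near the unit sphere, the barriers
have to control the boundary themselves.

Upper bound: the expanding hyperbolic metric of a smaller ball of radius `r` is infinite on its
boundary, so `f` cannot touch it there; then `r → 1` (`le_hyperbolic`).

Lower bound: the barrier is the expected solution times `(1 - σ(t)/(1 - |x|²))₊ᴶ`, which vanishes
near the unit sphere, while `f > 0`. Its zero region grows, since `σ(t) = ε exp(K t)`. For suitable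
`J` and `K` it is a strict subsolution wherever it is positive, as long as `σ ≤ 1/4`; this is
`lower_barrier_inequality`, where `m ≥ 3` enters. Then `ε → 0` (`hyperbolic_le`). -/

open Filter Topology

/-! ### Partial derivatives, touching functions, radial functions. -/

section Calculus

variable {m : ℕ}

theorem partialDeriv_congr {f g : EuclideanSpace ℝ (Fin m) → ℝ} {x : EuclideanSpace ℝ (Fin m)}
    (k : Fin m) (h : f =ᶠ[𝓝 x] g) : partialDeriv k f =ᶠ[𝓝 x] partialDeriv k g := by
  filter_upwards [h.fderiv (𝕜 := ℝ)] with y hy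
  simp only [partialDeriv, hy]

/-- The Laplacian of `f` on `ℝᵐ`. -/
noncomputable def euclideanLaplacian (f : EuclideanSpace ℝ (Fin m) → ℝ)
    (x : EuclideanSpace ℝ (Fin m)) : ℝ :=
  ∑ k, partialDeriv k (partialDeriv k f) x

/-- The squared length of the gradient of `f` on `ℝᵐ`. -/
noncomputable def gradientNormSq (f : EuclideanSpace ℝ (Fin m) → ℝ)
    (x : EuclideanSpace ℝ (Fin m)) : ℝ :=
  ∑ k, partialDeriv k f x ^ 2

/-- The right-hand side of the Yamabe flow equation `∂f/∂t = yamabeOperator f` for the conformally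
flat metric `f |dx|²`. -/
noncomputable def yamabeOperator (f : EuclideanSpace ℝ (Fin m) → ℝ)
    (x : EuclideanSpace ℝ (Fin m)) : ℝ :=
  ((m : ℝ) - 1) * (euclideanLaplacian f x / f x
    + ((m : ℝ) - 6) / 4 * (gradientNormSq f x / f x ^ 2))

theorem contDiffAt_partialDeriv {f : EuclideanSpace ℝ (Fin m) → ℝ}
    {x : EuclideanSpace ℝ (Fin m)} (k : Fin m) (hf : ContDiffAt ℝ 2 f x) :
    ContDiffAt ℝ 1 (partialDeriv k f) x :=
  (hf.fderiv_right (m := 1) (by norm_num)).clm_apply contDiffAt_const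

theorem partialDeriv_sub {f g : EuclideanSpace ℝ (Fin m) → ℝ} {x : EuclideanSpace ℝ (Fin m)}
    (k : Fin m) (hf : DifferentiableAt ℝ f x) (hg : DifferentiableAt ℝ g x) :
    partialDeriv k (fun y => f y - g y) x = partialDeriv k f x - partialDeriv k g x := by
  simp [partialDeriv, fderiv_fun_sub hf hg]

theorem partialDeriv_add {f g : EuclideanSpace ℝ (Fin m) → ℝ} {x : EuclideanSpace ℝ (Fin m)}
    (k : Fin m) (hf : DifferentiableAt ℝ f x) (hg : DifferentiableAt ℝ g x) :
    partialDeriv k (fun y => f y + g y) x = partialDeriv k f x + partialDeriv k g x := by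
  simp [partialDeriv, fderiv_fun_add hf hg]

theorem partialDeriv_mul_const {f : EuclideanSpace ℝ (Fin m) → ℝ}
    {x : EuclideanSpace ℝ (Fin m)} (k : Fin m) (hf : DifferentiableAt ℝ f x) (c : ℝ) :
    partialDeriv k (fun y => f y * c) x = partialDeriv k f x * c := by
  rw [partialDeriv, fderiv_mul_const hf]
  simp [partialDeriv, mul_comm]

theorem partialDeriv_div {f g : EuclideanSpace ℝ (Fin m) → ℝ} {x : EuclideanSpace ℝ (Fin m)}
    (k : Fin m) (hf : DifferentiableAt ℝ f x) (hg : DifferentiableAt ℝ g x) (h0 : g x ≠ 0) :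
    partialDeriv k (fun y => f y / g y) x
      = (partialDeriv k f x * g x - f x * partialDeriv k g x) / g x ^ 2 := by
  have hinv := (hasDerivAt_inv h0).comp_hasFDerivAt x hg.hasFDerivAt
  have := (hf.hasFDerivAt.mul hinv).fderiv
  simp only [partialDeriv, div_eq_mul_inv]
  erw [this]
  simp
  field_simp
  ring

/-- A function with a local maximum has nonpositive second partial derivatives there. -/
theorem partialDeriv_partialDeriv_nonpos_of_isLocalMax {f : EuclideanSpace ℝ (Fin m) → ℝ}
    {x : EuclideanSpace ℝ (Fin m)} (hf : ContDiffAt ℝ 2 f x) (hmax : IsLocalMax f x)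
    (k : Fin m) : partialDeriv k (partialDeriv k f) x ≤ 0 := by
  set e : EuclideanSpace ℝ (Fin m) := EuclideanSpace.single k 1
  have hline : ∀ s : ℝ, HasDerivAt (fun s : ℝ => x + s • e) e s := fun s => by
    simpa using ((hasDerivAt_id s).smul_const e).const_add x
  have hcont : Tendsto (fun s : ℝ => x + s • e) (𝓝 0) (𝓝 x) := by
    simpa using (hline 0).continuousAt.tendsto
  set φ : ℝ → ℝ := fun s => f (x + s • e)
  have hdiff : ∀ᶠ y in 𝓝 x, DifferentiableAt ℝ f y :=
    (hf.eventually (by simp)).mono fun y hy => hy.differentiableAt (by norm_num)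
  have hφ' : deriv φ =ᶠ[𝓝 0] fun s => partialDeriv k f (x + s • e) := by
    filter_upwards [hcont.eventually hdiff] with s hs
    exact (hs.hasFDerivAt.comp_hasDerivAt s (hline s)).deriv
  have hφ'' : deriv (deriv φ) 0 = partialDeriv k (partialDeriv k f) x := by
    rw [hφ'.deriv_eq]
    have h1 : DifferentiableAt ℝ (partialDeriv k f) (x + (0 : ℝ) • e) := by
      simpa using (contDiffAt_partialDeriv k hf).differentiableAt (by norm_num)
    have := (h1.hasFDerivAt.comp_hasDerivAt (0 : ℝ) (hline 0)).deriv
    simpa [Function.comp_def, partialDeriv] using this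
  have hlmax : IsLocalMax φ 0 := by
    have := hcont.eventually hmax
    filter_upwards [this] with s hs
    simpa [φ] using hs
  rw [← hφ'']
  -- A positive second derivative would make `0` a local minimum as well, so `φ` would be locally
  -- constant and its second derivative zero.
  by_contra! hpos
  have hc : ContinuousAt φ 0 := by
    have : ContinuousAt f (x + (0 : ℝ) • e) := by simpa using hf.continuousAt
    exact ContinuousAt.comp (f := fun s : ℝ => x + s • e) this (hline 0).continuousAt
  have hlmin := isLocalMin_of_deriv_deriv_pos hpos hlmax.deriv_eq_zero hc
  have hconst : φ =ᶠ[𝓝 0] fun _ => φ 0 := by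
    filter_upwards [hlmax, hlmin] with s h1 h2 using le_antisymm h1 h2
  rw [hconst.deriv.deriv_eq] at hpos
  simp at hpos

/-- The comparison principle at a point where `f` touches `v` from below. -/
theorem yamabeOperator_le_of_touching {f v : EuclideanSpace ℝ (Fin m) → ℝ} (hm : 1 ≤ m)
    {x : EuclideanSpace ℝ (Fin m)} (hf : ContDiffAt ℝ 2 f x) (hv : ContDiffAt ℝ 2 v x)
    (hle : ∀ᶠ y in 𝓝 x, f y ≤ v y) (heq : f x = v x) (hpos : 0 < f x) :
    yamabeOperator f x ≤ yamabeOperator v x := by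
  have hmax : IsLocalMax (fun y => f y - v y) x := by
    filter_upwards [hle] with y hy
    linarith
  have hd : ∀ {u : EuclideanSpace ℝ (Fin m) → ℝ}, ContDiffAt ℝ 2 u x →
      ∀ᶠ y in 𝓝 x, DifferentiableAt ℝ u y := fun hu =>
    (hu.eventually (by simp)).mono fun y hy => hy.differentiableAt (by norm_num)
  have h1 : ∀ k, partialDeriv k f x = partialDeriv k v x := fun k => by
    have := partialDeriv_sub k (hd hf).self_of_nhds (hd hv).self_of_nhds
    have h0 : partialDeriv k (fun y => f y - v y) x = 0 := by
      simp [partialDeriv, hmax.fderiv_eq_zero]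
    linarith
  have h2 : ∀ k, partialDeriv k (partialDeriv k f) x ≤ partialDeriv k (partialDeriv k v) x :=
    fun k => by
    have hle := partialDeriv_partialDeriv_nonpos_of_isLocalMax (hf.sub hv) hmax k
    have he : partialDeriv k (fun y => f y - v y) =ᶠ[𝓝 x]
        fun y => partialDeriv k f y - partialDeriv k v y := by
      filter_upwards [hd hf, hd hv] with y using partialDeriv_sub k
    have := (partialDeriv_congr k he).eq_of_nhds
    rw [partialDeriv_sub k ((contDiffAt_partialDeriv k hf).differentiableAt (by norm_num))
      ((contDiffAt_partialDeriv k hv).differentiableAt (by norm_num))] at this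
    change partialDeriv k (partialDeriv k (fun y => f y - v y)) x ≤ 0 at hle
    linarith
  have h3 : (0 : ℝ) ≤ (m : ℝ) - 1 := by
    have : (1 : ℝ) ≤ m := by exact_mod_cast hm
    linarith
  have h4 : euclideanLaplacian f x ≤ euclideanLaplacian v x :=
    Finset.sum_le_sum fun k _ => h2 k
  have h5 : gradientNormSq f x = gradientNormSq v x := by simp [gradientNormSq, h1]
  have h6 : 0 < v x := heq ▸ hpos
  rw [yamabeOperator, yamabeOperator, h5, heq]
  -- Only the Laplacians still differ; their coefficient `(m - 1) / v x` is nonnegative.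
  gcongr

theorem partialDeriv_radial {F : ℝ → ℝ} {F' : ℝ} {x : EuclideanSpace ℝ (Fin m)} (k : Fin m)
    (hF : HasDerivAt F F' (‖x‖ ^ 2)) :
    partialDeriv k (fun y => F (‖y‖ ^ 2)) x = 2 * F' * x k := by
  have h := hF.comp_hasFDerivAt x (hasStrictFDerivAt_norm_sq x).hasFDerivAt
  have := h.fderiv
  rw [Function.comp_def] at this
  rw [partialDeriv, this]
  simp [EuclideanSpace.inner_single_right]
  ring

theorem hasFDerivAt_coord (x : EuclideanSpace ℝ (Fin m)) (k : Fin m) :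
    HasFDerivAt (fun y : EuclideanSpace ℝ (Fin m) => y k)
      (EuclideanSpace.proj k : EuclideanSpace ℝ (Fin m) →L[ℝ] ℝ) x :=
  (EuclideanSpace.proj k : EuclideanSpace ℝ (Fin m) →L[ℝ] ℝ).hasFDerivAt

/-- The operator on a radial function `F(|x|²)` in terms of the logarithmic derivative `L` of
`F`. -/
theorem yamabeOperator_radial {F L : ℝ → ℝ} {L' : ℝ} {x : EuclideanSpace ℝ (Fin m)}
    (hF : ∀ᶠ q in 𝓝 (‖x‖ ^ 2), HasDerivAt F (F q * L q) q) (hL : HasDerivAt L L' (‖x‖ ^ 2))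
    (h0 : F (‖x‖ ^ 2) ≠ 0) :
    yamabeOperator (fun y => F (‖y‖ ^ 2)) x
      = ((m : ℝ) - 1) * (4 * ‖x‖ ^ 2 * L' + 2 * m * L (‖x‖ ^ 2)
        + ((m : ℝ) - 2) * ‖x‖ ^ 2 * L (‖x‖ ^ 2) ^ 2) := by
  have hsum : ∑ k, x k ^ 2 = ‖x‖ ^ 2 := (EuclideanSpace.real_norm_sq_eq x).symm
  have hc : Tendsto (fun y : EuclideanSpace ℝ (Fin m) => ‖y‖ ^ 2) (𝓝 x) (𝓝 (‖x‖ ^ 2)) :=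
    (continuous_norm.pow 2).continuousAt
  have h1 : ∀ k, partialDeriv k (fun y : EuclideanSpace ℝ (Fin m) => F (‖y‖ ^ 2)) =ᶠ[𝓝 x]
      fun y => 2 * (F (‖y‖ ^ 2) * L (‖y‖ ^ 2)) * y k := fun k => by
    filter_upwards [hc.eventually hF] with y hy using partialDeriv_radial k hy
  have h2 : ∀ k, partialDeriv k (partialDeriv k
      (fun y : EuclideanSpace ℝ (Fin m) => F (‖y‖ ^ 2))) x
      = 4 * F (‖x‖ ^ 2) * (L (‖x‖ ^ 2) ^ 2 + L') * x k ^ 2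
        + 2 * (F (‖x‖ ^ 2) * L (‖x‖ ^ 2)) := fun k => by
    rw [(partialDeriv_congr k (h1 k)).eq_of_nhds]
    have hG := ((hF.self_of_nhds.mul hL).const_mul 2)
    have hGx := hG.comp_hasFDerivAt x (hasStrictFDerivAt_norm_sq x).hasFDerivAt
    have := (hGx.mul (hasFDerivAt_coord x k)).fderiv
    rw [partialDeriv]
    erw [this]
    simp [EuclideanSpace.inner_single_right]
    ring
  have hlap : euclideanLaplacian (fun y : EuclideanSpace ℝ (Fin m) => F (‖y‖ ^ 2)) x
      = 4 * F (‖x‖ ^ 2) * (L (‖x‖ ^ 2) ^ 2 + L') * ‖x‖ ^ 2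
        + 2 * m * (F (‖x‖ ^ 2) * L (‖x‖ ^ 2)) := by
    simp only [euclideanLaplacian, h2, Finset.sum_add_distrib, ← Finset.mul_sum, hsum]
    simp
    ring
  have hgrad : gradientNormSq (fun y : EuclideanSpace ℝ (Fin m) => F (‖y‖ ^ 2)) x
      = 4 * F (‖x‖ ^ 2) ^ 2 * L (‖x‖ ^ 2) ^ 2 * ‖x‖ ^ 2 := by
    simp only [gradientNormSq, fun k => (h1 k).eq_of_nhds, ← hsum, Finset.mul_sum]
    exact Finset.sum_congr rfl fun k _ => by ring
  -- `F` cancels because the operator is invariant under scaling; the `L²` terms combine as `4 + (m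
  -- - 6) = m - 2`.
  rw [yamabeOperator, hlap, hgrad]
  field_simp
  ring

end Calculus

/-! ### Scalar curvature of conformally flat metrics. -/

section Curvature

variable {m : ℕ}

theorem inv_smul_one_matrix {c : ℝ} (hc : c ≠ 0) :
    (c • (1 : Matrix (Fin m) (Fin m) ℝ))⁻¹ = c⁻¹ • (1 : Matrix (Fin m) (Fin m) ℝ) :=
  Matrix.inv_eq_right_inv (by simp [smul_smul, hc])

/-- The Christoffel symbols of the conformally flat metric `f |dx|²`. -/
theorem christoffel_conformal {g : TensorField m} {f : EuclideanSpace ℝ (Fin m) → ℝ}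
    {x : EuclideanSpace ℝ (Fin m)}
    (hg : g =ᶠ[𝓝 x] fun y => f y • (1 : Matrix (Fin m) (Fin m) ℝ))
    (hf : DifferentiableAt ℝ f x) (h0 : f x ≠ 0) (k i j : Fin m) :
    christoffel g k i j x
      = (1 : Matrix (Fin m) (Fin m) ℝ) j k * (partialDeriv i f x / (2 * f x))
        + (1 : Matrix (Fin m) (Fin m) ℝ) i k * (partialDeriv j f x / (2 * f x))
        - (1 : Matrix (Fin m) (Fin m) ℝ) i j * (partialDeriv k f x / (2 * f x)) := by
  have hp : ∀ a b c, partialDeriv a (fun y => g y b c) x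
      = partialDeriv a f x * (1 : Matrix (Fin m) (Fin m) ℝ) b c := fun a b c => by
    rw [← partialDeriv_mul_const a hf]
    refine (partialDeriv_congr a ?_).eq_of_nhds
    filter_upwards [hg] with y hy
    simp [hy]
  have h : ∀ l, (g x)⁻¹ k l *
      (partialDeriv i (fun y => g y j l) x + partialDeriv j (fun y => g y i l) x
      - partialDeriv l (fun y => g y i j) x)
      = if k = l then (f x)⁻¹ * (partialDeriv i f x * (1 : Matrix (Fin m) (Fin m) ℝ) j l
        + partialDeriv j f x * (1 : Matrix (Fin m) (Fin m) ℝ) i l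
        - partialDeriv l f x * (1 : Matrix (Fin m) (Fin m) ℝ) i j) else 0 := fun l => by
    rw [hg.eq_of_nhds, inv_smul_one_matrix h0, hp, hp, hp]
    simp [Matrix.one_apply]
  rw [christoffel, Finset.sum_congr rfl fun l _ => h l]
  simp only [Finset.sum_ite_eq, Finset.mem_univ, if_true]
  field_simp

/-- The Kronecker delta bookkeeping behind the conformal scalar curvature: `a` stands for the
gradient of `½ log f`, `B i j` for `∂ᵢ aⱼ`, and the left side is the full contraction of the Riemann
tensor before the factor `1/f`. -/
theorem sum_christoffel_contraction (a : Fin m → ℝ) (B : Fin m → Fin m → ℝ) :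
    ∑ k, ∑ l, ((2 * (1 : Matrix (Fin m) (Fin m) ℝ) k l * B l k - B l l) - B k k
      + ∑ p, (a p * (2 * (1 : Matrix (Fin m) (Fin m) ℝ) k p * a k - a p)
        - ((1 : Matrix (Fin m) (Fin m) ℝ) p l * a k + (1 : Matrix (Fin m) (Fin m) ℝ) k l * a p
            - (1 : Matrix (Fin m) (Fin m) ℝ) k p * a l)
          * ((1 : Matrix (Fin m) (Fin m) ℝ) k p * a l + (1 : Matrix (Fin m) (Fin m) ℝ) l p * a k
            - (1 : Matrix (Fin m) (Fin m) ℝ) l k * a p)))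
      = (2 - 2 * m) * ∑ k, B k k - ((m : ℝ) - 1) * (m - 2) * ∑ k, a k ^ 2 := by
  have h : ∀ k l : Fin m, ∑ p, (a p * (2 * (1 : Matrix (Fin m) (Fin m) ℝ) k p * a k - a p)
        - ((1 : Matrix (Fin m) (Fin m) ℝ) p l * a k + (1 : Matrix (Fin m) (Fin m) ℝ) k l * a p
            - (1 : Matrix (Fin m) (Fin m) ℝ) k p * a l)
          * ((1 : Matrix (Fin m) (Fin m) ℝ) k p * a l + (1 : Matrix (Fin m) (Fin m) ℝ) l p * a k
            - (1 : Matrix (Fin m) (Fin m) ℝ) l k * a p))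
      = 2 * a k ^ 2 - ∑ p, a p ^ 2 - a k ^ 2 + a l ^ 2
        + (1 : Matrix (Fin m) (Fin m) ℝ) k l * (∑ p, a p ^ 2 - 2 * a k ^ 2) := fun k l => by
    have : ∀ p, (a p * (2 * (1 : Matrix (Fin m) (Fin m) ℝ) k p * a k - a p)
        - ((1 : Matrix (Fin m) (Fin m) ℝ) p l * a k + (1 : Matrix (Fin m) (Fin m) ℝ) k l * a p
            - (1 : Matrix (Fin m) (Fin m) ℝ) k p * a l)
          * ((1 : Matrix (Fin m) (Fin m) ℝ) k p * a l + (1 : Matrix (Fin m) (Fin m) ℝ) l p * a k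
            - (1 : Matrix (Fin m) (Fin m) ℝ) l k * a p))
        = (if k = p then 2 * a k ^ 2 + a l ^ 2 - 2 * (1 : Matrix (Fin m) (Fin m) ℝ) k l * a k ^ 2
            else 0)
          - a p ^ 2 - (if l = p then a k ^ 2 else 0)
          + (1 : Matrix (Fin m) (Fin m) ℝ) k l * a p ^ 2 := fun p => by
      simp only [Matrix.one_apply]
      by_cases h1 : k = p <;> by_cases h2 : k = l <;> by_cases h3 : l = p <;>
        simp_all [eq_comm] <;> ring
    simp only [this, Finset.sum_add_distrib, Finset.sum_sub_distrib, Finset.sum_ite_eq,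
      Finset.mem_univ, if_true, ← Finset.mul_sum]
    ring
  simp only [h]
  have h' : ∀ k, ∑ l, ((2 * (1 : Matrix (Fin m) (Fin m) ℝ) k l * B l k - B l l) - B k k
      + (2 * a k ^ 2 - ∑ p, a p ^ 2 - a k ^ 2 + a l ^ 2
        + (1 : Matrix (Fin m) (Fin m) ℝ) k l * (∑ p, a p ^ 2 - 2 * a k ^ 2)))
      = 2 * B k k - ∑ l, B l l - m * B k k + m * (a k ^ 2 - ∑ p, a p ^ 2)
        + 2 * ∑ p, a p ^ 2 - 2 * a k ^ 2 := fun k => by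
    simp [Matrix.one_apply, Finset.sum_add_distrib, Finset.sum_sub_distrib]
    ring
  simp only [h', Finset.sum_add_distrib, Finset.sum_sub_distrib, ← Finset.mul_sum]
  simp
  ring

/-- The scalar curvature of the conformally flat metric `f |dx|²`. -/
theorem scalarCurvature_conformal {g : TensorField m} {f : EuclideanSpace ℝ (Fin m) → ℝ}
    {x : EuclideanSpace ℝ (Fin m)}
    (hg : g =ᶠ[𝓝 x] fun y => f y • (1 : Matrix (Fin m) (Fin m) ℝ))
    (hf : ContDiffAt ℝ 2 f x) (h0 : f x ≠ 0) :
    -scalarCurvature g x * f x = yamabeOperator f x := by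
  -- `a` is the gradient of `½ log f`; the Christoffel symbols are linear in it with constant
  -- coefficients.
  set a : Fin m → EuclideanSpace ℝ (Fin m) → ℝ := fun i y => partialDeriv i f y / (2 * f y)
    with ha
  have hfd : ∀ᶠ y in 𝓝 x, DifferentiableAt ℝ f y :=
    (hf.eventually (by simp)).mono fun y hy => hy.differentiableAt (by norm_num)
  have hpd : ∀ i, DifferentiableAt ℝ (partialDeriv i f) x := fun i =>
    (contDiffAt_partialDeriv i hf).differentiableAt (by norm_num)
  have hd2 : DifferentiableAt ℝ (fun y => f y * 2) x :=
    hfd.self_of_nhds.mul_const 2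
  have hda : ∀ i, DifferentiableAt ℝ (a i) x := fun i => by
    have h2 : DifferentiableAt ℝ (fun y => 2 * f y) x := hfd.self_of_nhds.const_mul 2
    simp only [ha, div_eq_mul_inv]
    exact (hpd i).fun_mul (h2.fun_inv (by simpa using h0))
  have hB : ∀ i, partialDeriv i (a i) x = partialDeriv i (partialDeriv i f) x / (2 * f x)
      - partialDeriv i f x ^ 2 / (2 * f x ^ 2) := fun i => by
    simp only [ha, mul_comm (2 : ℝ)]
    rw [partialDeriv_div i (hpd i) hd2 (by simpa using h0),
      partialDeriv_mul_const i hfd.self_of_nhds]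
    field_simp
  have hΓ : ∀ k i j, christoffel g k i j =ᶠ[𝓝 x] fun y =>
      a i y * (1 : Matrix (Fin m) (Fin m) ℝ) j k + a j y * (1 : Matrix (Fin m) (Fin m) ℝ) i k
        - a k y * (1 : Matrix (Fin m) (Fin m) ℝ) i j := fun k i j => by
    filter_upwards [hg.eventuallyEq_nhds, hfd, hf.continuousAt.eventually_ne h0] with y h1 h2 h3
    rw [christoffel_conformal h1 h2 h3]
    ring
  have hΓd : ∀ n k i j, partialDeriv n (christoffel g k i j) x =
      partialDeriv n (a i) x * (1 : Matrix (Fin m) (Fin m) ℝ) j k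
        + partialDeriv n (a j) x * (1 : Matrix (Fin m) (Fin m) ℝ) i k
        - partialDeriv n (a k) x * (1 : Matrix (Fin m) (Fin m) ℝ) i j := fun n k i j => by
    rw [(partialDeriv_congr n (hΓ k i j)).eq_of_nhds, partialDeriv_sub, partialDeriv_add,
      partialDeriv_mul_const _ (hda _), partialDeriv_mul_const _ (hda _),
      partialDeriv_mul_const _ (hda _)]
    · exact (hda _).mul_const _
    · exact (hda _).mul_const _
    · exact ((hda _).mul_const _).fun_add ((hda _).mul_const _)
    · exact (hda _).mul_const _
  have hR : scalarCurvature g x = (f x)⁻¹ * ∑ k, ∑ l, riemannTensor g l k l k x := by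
    have : ∀ k j, (g x)⁻¹ k j * ricciTensor g k j x
        = if k = j then (f x)⁻¹ * ricciTensor g k j x else 0 := fun k j => by
      rw [hg.eq_of_nhds, inv_smul_one_matrix h0]
      simp [Matrix.one_apply]
    simp only [scalarCurvature, this, Finset.sum_ite_eq, Finset.mem_univ, if_true,
      ← Finset.mul_sum]
    rfl
  have hcomm : ∀ i j, (1 : Matrix (Fin m) (Fin m) ℝ) i j = (1 : Matrix (Fin m) (Fin m) ℝ) j i :=
    fun i j => by simp [Matrix.one_apply, eq_comm]
  have hsum := sum_christoffel_contraction (fun i => a i x) (fun i j => partialDeriv i (a j) x)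
  have hriem : ∑ k, ∑ l, riemannTensor g l k l k x
      = (2 - 2 * m) * ∑ k, partialDeriv k (a k) x
        - ((m : ℝ) - 1) * (m - 2) * ∑ k, a k x ^ 2 := by
    rw [← hsum]
    refine Finset.sum_congr rfl fun k _ => Finset.sum_congr rfl fun l _ => ?_
    rw [riemannTensor, hΓd, hΓd]
    congr 1
    · rw [hcomm l k]
      simp
      ring
    · refine Finset.sum_congr rfl fun p _ => ?_
      rw [(hΓ l l p).eq_of_nhds, (hΓ p k k).eq_of_nhds, (hΓ l k p).eq_of_nhds,
        (hΓ p l k).eq_of_nhds, hcomm p l, hcomm l k]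
      simp
      ring
  have hsB : ∑ k, partialDeriv k (a k) x
      = euclideanLaplacian f x / (2 * f x) - gradientNormSq f x / (2 * f x ^ 2) := by
    simp only [hB, Finset.sum_sub_distrib, euclideanLaplacian, gradientNormSq, Finset.sum_div]
  have hsa : ∑ k, a k x ^ 2 = gradientNormSq f x / (4 * f x ^ 2) := by
    simp only [ha, gradientNormSq, Finset.sum_div, div_pow, mul_pow]
    norm_num
  rw [hR, hriem, hsB, hsa, yamabeOperator]
  field_simp
  ring

end Curvature

/-! ### First touching times and the upper bound. -/

section Comparison

variable {m : ℕ}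

/-- A function that is negative initially and nonnegative somewhere later has a first zero. -/
theorem exists_first_touching {X : Type*} [TopologicalSpace X] [T2Space X] {K : Set X}
    (hK : IsCompact K) {τ : ℝ} {G : ℝ → X → ℝ}
    (hG : ContinuousOn (fun p : ℝ × X => G p.1 p.2) (Set.Icc 0 τ ×ˢ K))
    (h0 : ∀ x ∈ K, G 0 x < 0) {t : ℝ} {x : X} (ht : t ∈ Set.Icc 0 τ) (hx : x ∈ K)
    (h : 0 ≤ G t x) :
    ∃ s ∈ Set.Ioc 0 τ, ∃ z ∈ K, G s z = 0 ∧ (∀ y ∈ K, G s y ≤ 0) ∧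
      ∀ r ∈ Set.Ico 0 s, G r z < 0 := by
  have hcpt : IsCompact (Set.Icc 0 τ ×ˢ K) := isCompact_Icc.prod hK
  have hS : IsCompact ((Set.Icc 0 τ ×ˢ K) ∩ (fun p : ℝ × X => G p.1 p.2) ⁻¹' Set.Ici 0) :=
    hcpt.of_isClosed_subset (hG.preimage_isClosed_of_isClosed hcpt.isClosed isClosed_Ici)
      Set.inter_subset_left
  -- A point of least time in the compact set `{G ≥ 0}`.
  obtain ⟨⟨s, z⟩, ⟨⟨hs, hz⟩, hsz⟩, hmin⟩ :=
    hS.exists_isMinOn ⟨(t, x), ⟨ht, hx⟩, h⟩ continuous_fst.continuousOn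
  have hs0 : 0 < s := lt_of_le_of_ne hs.1 fun he => by
    subst he
    exact absurd hsz (not_le.2 (h0 z hz))
  have hneg : ∀ r ∈ Set.Ico 0 s, ∀ y ∈ K, G r y < 0 := fun r hr y hy => by
    by_contra! hc
    exact absurd (hmin (a := (r, y)) ⟨⟨⟨hr.1, hr.2.le.trans hs.2⟩, hy⟩, hc⟩) (not_le.2 hr.2)
  have hle : ∀ y ∈ K, G s y ≤ 0 := fun y hy => by
    have hc : ContinuousWithinAt (fun r => G r y) (Set.Ico 0 s) s := by
      refine ContinuousWithinAt.comp (g := fun p : ℝ × X => G p.1 p.2) (f := fun r => (r, y))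
        (hG (s, y) ⟨hs, hy⟩) (by fun_prop) fun r hr => ⟨⟨hr.1, hr.2.le.trans hs.2⟩, hy⟩
    have : (𝓝[Set.Ico 0 s] s).NeBot := right_nhdsWithin_Ico_neBot hs0
    exact le_of_tendsto hc (eventually_mem_nhdsWithin.mono fun r hr => (hneg r hr y hy).le)
  exact ⟨s, ⟨hs0, hs.2⟩, z, hz, le_antisymm (hle z hz) hsz, hle, fun r hr => hneg r hr z hz⟩

/-- The difference quotients from the left are nonnegative. Only the past of `s` is used. -/
theorem nonneg_of_hasDerivWithinAt_of_forall_le {u : ℝ → ℝ} {u' s : ℝ} {I : Set ℝ}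
    (hs : 0 < s) (hI : Set.Icc 0 s ⊆ I) (hu : HasDerivWithinAt u u' I s)
    (hle : ∀ r ∈ Set.Ico 0 s, u r ≤ u s) : 0 ≤ u' := by
  have h := hu.mono (Set.Ico_subset_Icc_self.trans hI)
  rw [hasDerivWithinAt_iff_tendsto_slope' (by simp)] at h
  have : (𝓝[Set.Ico 0 s] s).NeBot := right_nhdsWithin_Ico_neBot hs
  refine ge_of_tendsto h (eventually_mem_nhdsWithin.mono fun r hr => ?_)
  rw [slope_def_field]
  exact div_nonneg_of_nonpos (sub_nonpos.2 (hle r hr)) (sub_nonpos.2 hr.2.le)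

theorem Icc_subset_timeInterval {T : EReal} {τ : ℝ} (hτ : τ ∈ timeInterval T) :
    Set.Icc 0 τ ⊆ timeInterval T := fun _ ht =>
  ⟨ht.1, (EReal.coe_le_coe_iff.2 ht.2).trans_lt hτ.2⟩

/-- The conformal factors `f` of the Yamabe flows `f |dx|²` on the unit ball with hyperbolic
initial metric. -/
structure IsConformalYamabeFlow (m : ℕ) (T : EReal) (f : ℝ → EuclideanSpace ℝ (Fin m) → ℝ) :
    Prop where
  pos : ∀ t ∈ timeInterval T, ∀ x ∈ hyperbolicBall m, 0 < f t x
  contDiffOn : ∀ t ∈ timeInterval T, ContDiffOn ℝ 2 (f t) (hyperbolicBall m)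
  continuousOn : ContinuousOn (fun p : ℝ × EuclideanSpace ℝ (Fin m) => f p.1 p.2)
    (timeInterval T ×ˢ hyperbolicBall m)
  evolution : ∀ t ∈ timeInterval T, ∀ x ∈ hyperbolicBall m,
    HasDerivWithinAt (fun s => f s x) (yamabeOperator (f t) x) (timeInterval T) t
  initial : ∀ x ∈ hyperbolicBall m, f 0 x = 4 / (1 - ‖x‖ ^ 2) ^ 2

theorem mem_hyperbolicBall {x : EuclideanSpace ℝ (Fin m)} :
    x ∈ hyperbolicBall m ↔ 0 < 1 - ‖x‖ ^ 2 := by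
  rw [hyperbolicBall, mem_ball_zero_iff, sub_pos, sq_lt_one_iff₀ (norm_nonneg x)]

theorem isOpen_hyperbolicBall : IsOpen (hyperbolicBall m) := Metric.isOpen_ball

/-- Multiples of the hyperbolic metric of a ball of radius `√R`. -/
theorem yamabeOperator_hyperbolic {c R : ℝ} {x : EuclideanSpace ℝ (Fin m)} (hc : c ≠ 0)
    (hx : ‖x‖ ^ 2 < R) :
    yamabeOperator (fun y : EuclideanSpace ℝ (Fin m) => c / (R - ‖y‖ ^ 2) ^ 2) x
      = (m : ℝ) * (m - 1) * (4 * R) / (R - ‖x‖ ^ 2) ^ 2 := by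
  have hne : R - ‖x‖ ^ 2 ≠ 0 := (sub_pos.2 hx).ne'
  have hsub : ∀ q : ℝ, HasDerivAt (fun q : ℝ => R - q) (-1) q := fun q => by
    simpa using (hasDerivAt_id q).const_sub R
  have hF : ∀ᶠ q in 𝓝 (‖x‖ ^ 2), HasDerivAt (fun q : ℝ => c / (R - q) ^ 2)
      (c / (R - q) ^ 2 * (2 / (R - q))) q := by
    filter_upwards [eventually_lt_nhds hx] with q hq
    have hq : R - q ≠ 0 := (sub_pos.2 hq).ne'
    refine (((hasDerivAt_const q c).div ((hsub q).pow 2) (pow_ne_zero 2 hq))).congr_deriv ?_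
    field_simp
    simp
    ring
  have hL : HasDerivAt (fun q : ℝ => 2 / (R - q)) (2 / (R - ‖x‖ ^ 2) ^ 2) (‖x‖ ^ 2) := by
    refine ((hasDerivAt_const _ (2 : ℝ)).div (hsub _) hne).congr_deriv ?_
    simp
  rw [yamabeOperator_radial (F := fun q => c / (R - q) ^ 2) hF hL
    (div_ne_zero hc (pow_ne_zero 2 hne))]
  field_simp
  ring

theorem contDiffAt_hyperbolic {c R : ℝ} {x : EuclideanSpace ℝ (Fin m)} (hx : ‖x‖ ^ 2 < R) :
    ContDiffAt ℝ 2 (fun y : EuclideanSpace ℝ (Fin m) => c / (R - ‖y‖ ^ 2) ^ 2) x :=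
  contDiffAt_const.div ((contDiffAt_const.sub (contDiff_norm_sq ℝ).contDiffAt).pow 2)
    (pow_ne_zero 2 (sub_pos.2 hx).ne')

/-- Comparison with slightly enlarged expanding hyperbolic metrics on smaller balls. -/
theorem IsConformalYamabeFlow.le_upper_barrier (hm : 2 ≤ m) {T : EReal}
    {f : ℝ → EuclideanSpace ℝ (Fin m) → ℝ} (hf : IsConformalYamabeFlow m T f) {τ : ℝ}
    (hτ : τ ∈ timeInterval T) {r δ : ℝ} (hr0 : 0 < r) (hr1 : r < 1) (hδ : 0 < δ)
    {x : EuclideanSpace ℝ (Fin m)} (hx : ‖x‖ ≤ r) :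
    f τ x * (r ^ 2 - ‖x‖ ^ 2) ^ 2 ≤ 4 * r ^ 2 * (1 + δ + (m * (m - 1) + δ) * τ) := by
  by_contra! hcon
  have hm' : (2 : ℝ) ≤ m := by exact_mod_cast hm
  have hmm : 0 < (m : ℝ) * (m - 1) := mul_pos (by linarith) (by linarith)
  have hsub : Set.Icc 0 τ ⊆ timeInterval T := Icc_subset_timeInterval hτ
  have hball : Metric.closedBall (0 : EuclideanSpace ℝ (Fin m)) r ⊆ hyperbolicBall m :=
    Metric.closedBall_subset_ball hr1
  -- Multiplying by `(r² - |y|²)²` turns the barrier, infinite on the sphere of radius `r`, into a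
  -- function continuous on the closed ball. The `δ` in `1 + δ` gives strictness at time 0, the one
  -- in the slope a strict supersolution.
  obtain ⟨s, hs, z, hz, hsz, hle, hlt⟩ := exists_first_touching
    (G := fun t y => f t y * (r ^ 2 - ‖y‖ ^ 2) ^ 2
      - 4 * r ^ 2 * (1 + δ + (m * (m - 1) + δ) * t)) (τ := τ) (t := τ) (x := x)
    (isCompact_closedBall (0 : EuclideanSpace ℝ (Fin m)) r)
    (((hf.continuousOn.mono (Set.prod_mono hsub hball)).mul (by fun_prop)).sub (by fun_prop))
    (fun y hy => by
      have hy' : ‖y‖ ≤ r := by simpa using hy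
      have hpos := mem_hyperbolicBall.1 (hball hy)
      have h1 : 0 ≤ r ^ 2 - ‖y‖ ^ 2 := by
        have := norm_nonneg y
        nlinarith
      -- The difference of the two sides is `(1 - r)(r + |y|²)`: hyperbolic metrics grow when the
      -- ball shrinks.
      have h2 : r ^ 2 - ‖y‖ ^ 2 ≤ r * (1 - ‖y‖ ^ 2) := by
        nlinarith [mul_nonneg (sub_nonneg.2 hr1.le) (add_nonneg hr0.le (sq_nonneg ‖y‖))]
      have h3 : (r ^ 2 - ‖y‖ ^ 2) ^ 2 ≤ r ^ 2 * (1 - ‖y‖ ^ 2) ^ 2 := by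
        rw [← mul_pow]
        gcongr
      rw [hf.initial y (hball hy)]
      have h4 : 4 / (1 - ‖y‖ ^ 2) ^ 2 * (r ^ 2 - ‖y‖ ^ 2) ^ 2 ≤ 4 * r ^ 2 := by
        rw [div_mul_eq_mul_div, div_le_iff₀ (by positivity)]
        linarith
      have h5 : 0 < r ^ 2 * δ := by positivity
      linarith)
    ⟨hτ.1, le_rfl⟩ (by simpa using hx) (by linarith)
  have hpos : ∀ t, 0 ≤ t → 0 < 4 * r ^ 2 * (1 + δ + (m * (m - 1) + δ) * t) := fun t ht => by
    positivity
  have hzr : ‖z‖ < r := by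
    refine lt_of_le_of_ne (by simpa using hz) fun he => ?_
    rw [he] at hsz
    have := hpos s hs.1.le
    linarith
  have hzr2 : ‖z‖ ^ 2 < r ^ 2 := by gcongr
  have hzb := hball hz
  have hsT := hsub ⟨hs.1.le, hs.2⟩
  have hevent : ∀ᶠ y in 𝓝 z, ‖y‖ ^ 2 < r ^ 2 ∧ ‖y‖ < r :=
    ((continuous_norm.pow 2).continuousAt.eventually_lt_const hzr2).and
      (continuous_norm.continuousAt.eventually_lt_const hzr)
  have hop := yamabeOperator_le_of_touching (by lia : 1 ≤ m)
    ((hf.contDiffOn s hsT).contDiffAt (isOpen_hyperbolicBall.mem_nhds hzb))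
    (contDiffAt_hyperbolic (c := 4 * r ^ 2 * (1 + δ + (m * (m - 1) + δ) * s)) hzr2)
    (by
      filter_upwards [hevent] with y hy
      rw [le_div_iff₀ (pow_pos (sub_pos.2 hy.1) 2)]
      have := hle y (by simpa using hy.2.le)
      linarith)
    (by
      rw [eq_div_iff (pow_pos (sub_pos.2 hzr2) 2).ne']
      linarith)
    (hf.pos s hsT z hzb)
  rw [yamabeOperator_hyperbolic (hpos s hs.1.le).ne' hzr2,
    le_div_iff₀ (pow_pos (sub_pos.2 hzr2) 2)] at hop
  have hderiv : HasDerivWithinAt (fun t => f t z * (r ^ 2 - ‖z‖ ^ 2) ^ 2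
      - 4 * r ^ 2 * (1 + δ + (m * (m - 1) + δ) * t))
      (yamabeOperator (f s) z * (r ^ 2 - ‖z‖ ^ 2) ^ 2 - 4 * r ^ 2 * (m * (m - 1) + δ))
      (timeInterval T) s := by
    refine ((hf.evolution s hsT z hzb).mul_const _).fun_sub
      (HasDerivAt.hasDerivWithinAt ?_)
    simpa using (((hasDerivAt_id s).const_mul ((m : ℝ) * (m - 1) + δ)).const_add
      (1 + δ)).const_mul (4 * r ^ 2)
  -- By `hop` this derivative is at most `-4 r² δ`, which is the contradiction.
  have := nonneg_of_hasDerivWithinAt_of_forall_le hs.1 (Icc_subset_timeInterval hsT) hderiv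
    fun t ht => by
      rw [hsz]
      exact (hlt t ht).le
  have h5 : 0 < r ^ 2 * δ := by positivity
  linarith

theorem IsConformalYamabeFlow.le_hyperbolic (hm : 2 ≤ m) {T : EReal}
    {f : ℝ → EuclideanSpace ℝ (Fin m) → ℝ} (hf : IsConformalYamabeFlow m T f) {τ : ℝ}
    (hτ : τ ∈ timeInterval T) {x : EuclideanSpace ℝ (Fin m)} (hx : x ∈ hyperbolicBall m) :
    f τ x ≤ (m * (m - 1) * τ + 1) * (4 / (1 - ‖x‖ ^ 2) ^ 2) := by
  have hxpos := mem_hyperbolicBall.1 hx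
  have hx1 : ‖x‖ < 1 := by simpa [hyperbolicBall] using hx
  -- The barrier estimate with `δ = 1 - r`, in the limit `r → 1`.
  have h : f τ x * ((1 : ℝ) ^ 2 - ‖x‖ ^ 2) ^ 2
      ≤ 4 * 1 ^ 2 * (1 + (1 - 1) + (m * (m - 1) + (1 - 1)) * τ) := by
    have hl : ContinuousAt (fun r : ℝ => f τ x * (r ^ 2 - ‖x‖ ^ 2) ^ 2) 1 := by fun_prop
    have hr : ContinuousAt
        (fun r : ℝ => 4 * r ^ 2 * (1 + (1 - r) + (m * (m - 1) + (1 - r)) * τ)) 1 := by fun_prop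
    refine le_of_tendsto_of_tendsto (hl.tendsto.mono_left nhdsWithin_le_nhds)
      (hr.tendsto.mono_left (nhdsWithin_le_nhds (s := Set.Iio 1))) ?_
    have h1 : ∀ᶠ r : ℝ in 𝓝[<] 1, max 0 ‖x‖ < r :=
      (eventually_gt_nhds (by simpa using hx1)).filter_mono nhdsWithin_le_nhds
    filter_upwards [h1, self_mem_nhdsWithin] with r hr hr1
    exact hf.le_upper_barrier hm hτ ((le_max_left _ _).trans_lt hr) hr1 (sub_pos.2 hr1)
      ((le_max_right _ _).trans hr.le)
  rw [mul_div_assoc', le_div_iff₀ (by positivity)]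
  linarith

end Comparison

/-! ### Subsolutions vanishing near the unit sphere, and the lower bound. -/

section LowerBarrier

variable {m : ℕ}

/-- This is the strict subsolution property after removing a common factor, with `M = m`, `y = 1 -
|x|²`, `s = σ/y`, and `n + 1 = J` in the application. The only harmful term on the right is the one
linear in `z = s/(1 - s)`. For `s ≤ 1/2` the growth of `σ` compensates it; for `s > 1/2`, near the
edge of the support, the quadratic gradient term does. -/
theorem lower_barrier_inequality {M A s y J : ℝ} {n : ℕ} (hM : 3 ≤ M) (hA : 1 ≤ A)
    (hJ : J = 8 * M + 4) (hs0 : 0 < s) (hs1 : s < 1) (hy0 : 0 < y) (hy1 : y ≤ 1)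
    (hsy : s * y ≤ 1 / 4) :
    M * (1 - s) ^ (n + 1) - M * A * J * 2 ^ (n + 1) * s * (1 - s) ^ n
      < M - M * J / 2 * (2 - y) * (s / (1 - s))
        + (1 - y) * (J * ((M - 2) * J / 4 - 1)) * (s / (1 - s)) ^ 2 := by
  set z := s / (1 - s) with hz
  have h1s : 0 < 1 - s := by linarith
  have hz0 : 0 < z := by positivity
  have hJ0 : 0 < J := by linarith
  have hpow : (1 - s) ^ (n + 1) < 1 := pow_lt_one₀ h1s.le (by linarith) (by simp)
  have h1 : M * (1 - s) ^ (n + 1) < M := by nlinarith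
  have h2 : M * J / 2 * (2 - y) * z ≤ M * J * z := by
    have : 0 ≤ M * J * z * y := by positivity
    nlinarith
  -- With `J = 8M + 4` the difference is `(2M + 1)(M - 3)`, with equality at `M = 3`.
  have hcoef : 2 * M ≤ (M - 2) * J / 4 - 1 := by
    rw [hJ]
    nlinarith
  have hlast : 0 ≤ M * A * J * 2 ^ (n + 1) * s * (1 - s) ^ n := by positivity
  have hquad : 0 ≤ (1 - y) * (J * ((M - 2) * J / 4 - 1)) * z ^ 2 :=
    mul_nonneg (mul_nonneg (by linarith) (mul_nonneg hJ0.le (by linarith))) (sq_nonneg z)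
  rcases le_or_gt s (1 / 2) with hs | hs
  · have hz2 : z ≤ 2 * s := by
      rw [hz, div_le_iff₀ h1s]
      nlinarith
    have h3 : 1 ≤ 2 ^ n * (1 - s) ^ n := by
      rw [← mul_pow]
      exact one_le_pow₀ (by linarith)
    have h4 : M * J * z ≤ M * A * J * 2 ^ (n + 1) * s * (1 - s) ^ n := by
      calc M * J * z ≤ M * J * (2 * s) := by gcongr
        _ = (M * J * (2 * s)) * (1 * 1) := by ring
        _ ≤ (M * J * (2 * s)) * (A * (2 ^ n * (1 - s) ^ n)) := by gcongr
        _ = _ := by ring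
    linarith
  · have hz1 : 1 ≤ z := by
      rw [hz, le_div_iff₀ h1s]
      linarith
    -- From `s y ≤ 1/4` and `s > 1/2`: the quadratic term carries a factor `|x|² = 1 - y`, so it
    -- must stay away from the origin.
    have hy2 : 1 / 2 ≤ 1 - y := by nlinarith
    have h3 : M * J * z ≤ (1 - y) * (J * ((M - 2) * J / 4 - 1)) * z ^ 2 := by
      calc M * J * z ≤ M * J * z ^ 2 := by
            gcongr
            nlinarith
        _ = 1 / 2 * (J * (2 * M)) * z ^ 2 := by ring
        _ ≤ _ := by gcongr
    linarith

theorem yamabeOperator_lower_barrier {n : ℕ} {c σ : ℝ} {x : EuclideanSpace ℝ (Fin m)}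
    (hc : c ≠ 0) (hσ : 0 ≤ σ) (hx : σ < 1 - ‖x‖ ^ 2) :
    yamabeOperator (fun y : EuclideanSpace ℝ (Fin m) =>
        c * (1 - ‖y‖ ^ 2 - σ) ^ (n + 1) / (1 - ‖y‖ ^ 2) ^ (n + 3)) x
      = ((m : ℝ) - 1) * (4 * ‖x‖ ^ 2 * (-(n + 1) / (1 - ‖x‖ ^ 2 - σ) ^ 2
          + (n + 3) / (1 - ‖x‖ ^ 2) ^ 2)
        + 2 * m * (-(n + 1) / (1 - ‖x‖ ^ 2 - σ) + (n + 3) / (1 - ‖x‖ ^ 2))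
        + ((m : ℝ) - 2) * ‖x‖ ^ 2
          * (-(n + 1) / (1 - ‖x‖ ^ 2 - σ) + (n + 3) / (1 - ‖x‖ ^ 2)) ^ 2) := by
  have hx' : ‖x‖ ^ 2 < 1 - σ := by linarith
  have hsub : ∀ q : ℝ, HasDerivAt (fun q : ℝ => 1 - q) (-1) q := fun q => by
    simpa using (hasDerivAt_id q).const_sub 1
  have hsub' : ∀ q : ℝ, HasDerivAt (fun q : ℝ => 1 - q - σ) (-1) q := fun q =>
    (hsub q).sub_const σ
  have hF : ∀ᶠ q in 𝓝 (‖x‖ ^ 2),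
      HasDerivAt (fun q : ℝ => c * (1 - q - σ) ^ (n + 1) / (1 - q) ^ (n + 3))
      (c * (1 - q - σ) ^ (n + 1) / (1 - q) ^ (n + 3)
        * (-(n + 1) / (1 - q - σ) + (n + 3) / (1 - q))) q := by
    filter_upwards [eventually_lt_nhds hx'] with q hq
    have h1 : 1 - q - σ ≠ 0 := by linarith
    have h2 : 1 - q ≠ 0 := by linarith
    refine ((((hsub' q).pow (n + 1)).const_mul c).div ((hsub q).pow (n + 3))
      (pow_ne_zero _ h2)).congr_deriv ?_
    simp only [Nat.add_sub_cancel, Pi.pow_apply, show n + 3 - 1 = n + 2 from rfl]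
    push_cast
    field_simp
    ring
  have h1 : 1 - ‖x‖ ^ 2 - σ ≠ 0 := by linarith
  have h2 : 1 - ‖x‖ ^ 2 ≠ 0 := by linarith
  have hL : HasDerivAt (fun q : ℝ => -(n + 1) / (1 - q - σ) + (n + 3) / (1 - q))
      (-(n + 1) / (1 - ‖x‖ ^ 2 - σ) ^ 2 + (n + 3) / (1 - ‖x‖ ^ 2) ^ 2) (‖x‖ ^ 2) := by
    refine (((hasDerivAt_const _ (-((n : ℝ) + 1))).div (hsub' _) h1).add
      ((hasDerivAt_const _ ((n : ℝ) + 3)).div (hsub _) h2)).congr_deriv ?_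
    simp
  rw [yamabeOperator_radial (F := fun q => c * (1 - q - σ) ^ (n + 1) / (1 - q) ^ (n + 3)) hF hL
    (div_ne_zero (mul_ne_zero hc (pow_ne_zero _ h1)) (pow_ne_zero _ h2))]

/-- Comparison with the subsolutions
`4 (m(m-1)t + 1) (1 - |x|² - σ(t))₊ᴶ / (1 - |x|²)ᴶ⁺²`, where `σ(t) = ε exp(K t)` and
`J = 8 m + 4`. -/
theorem IsConformalYamabeFlow.lower_barrier_le (hm : 3 ≤ m) {T : EReal}
    {f : ℝ → EuclideanSpace ℝ (Fin m) → ℝ} (hf : IsConformalYamabeFlow m T f) {τ : ℝ}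
    (hτ : τ ∈ timeInterval T) {ε K : ℝ} (hε : 0 < ε)
    (hK : K = m * (m - 1) * 2 ^ (8 * m + 4)) (hετ : ε * Real.exp (K * τ) ≤ 1 / 4)
    {x : EuclideanSpace ℝ (Fin m)} (hx : ε ≤ 1 - ‖x‖ ^ 2) :
    4 * (m * (m - 1) * τ + 1) * (max (1 - ‖x‖ ^ 2 - ε * Real.exp (K * τ)) 0) ^ (8 * m + 4)
      / (1 - ‖x‖ ^ 2) ^ (8 * m + 6) ≤ f τ x := by
  obtain ⟨n, hn⟩ : ∃ n, 8 * m + 4 = n + 1 := ⟨8 * m + 3, rfl⟩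
  rw [show 8 * m + 6 = n + 3 by lia]
  rw [hn] at hK ⊢
  have hJ : (n : ℝ) + 1 = 8 * m + 4 := by exact_mod_cast hn.symm
  by_contra! hcon
  have hm' : (3 : ℝ) ≤ m := by exact_mod_cast hm
  have hmm : 0 < (m : ℝ) * (m - 1) := mul_pos (by linarith) (by linarith)
  have hK0 : 0 < K := by rw [hK]; positivity
  have hsub : Set.Icc 0 τ ⊆ timeInterval T := Icc_subset_timeInterval hτ
  -- A compact part of the ball outside which the barrier vanishes at every time `t ≥ 0`, since
  -- `σ(t) ≥ ε`.
  set S : Set (EuclideanSpace ℝ (Fin m)) := {y | ε ≤ 1 - ‖y‖ ^ 2} with hS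
  have hSball : S ⊆ hyperbolicBall m := fun y hy => mem_hyperbolicBall.2 (hε.trans_le hy)
  have hScpt : IsCompact S := by
    refine (isCompact_closedBall (0 : EuclideanSpace ℝ (Fin m)) 1).of_isClosed_subset
      (isClosed_le continuous_const (by fun_prop)) ?_
    exact hSball.trans Metric.ball_subset_closedBall
  obtain ⟨s, hs, z, hz, hsz, hle, hlt⟩ := exists_first_touching
    (G := fun t y => 4 * (m * (m - 1) * t + 1) * (max (1 - ‖y‖ ^ 2 - ε * Real.exp (K * t)) 0)
      ^ (n + 1) / (1 - ‖y‖ ^ 2) ^ (n + 3) - f t y) (τ := τ) (t := τ) (x := x) hScpt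
    ((ContinuousOn.div (by fun_prop) (by fun_prop) fun p hp =>
      pow_ne_zero _ (hε.trans_le hp.2).ne').sub
        (hf.continuousOn.mono (Set.prod_mono hsub hSball)))
    (fun y hy => by
      have hypos := mem_hyperbolicBall.1 (hSball hy)
      have h1 : max (1 - ‖y‖ ^ 2 - ε * Real.exp (K * 0)) 0 < 1 - ‖y‖ ^ 2 := by
        simp [hypos, hε]
      have h2 := pow_lt_pow_left₀ h1 (le_max_right _ _) (by simp : n + 1 ≠ 0)
      rw [hf.initial y (hSball hy), sub_neg, div_lt_div_iff₀ (by positivity) (by positivity),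
        show n + 3 = (n + 1) + 2 from rfl, pow_add (1 - ‖y‖ ^ 2) (n + 1) 2]
      have h3 : 0 < (1 - ‖y‖ ^ 2) ^ 2 := by positivity
      have := mul_lt_mul_of_pos_right h2 h3
      linarith)
    ⟨hτ.1, le_rfl⟩ hx (by linarith)
  have hzb := hSball hz
  have hypos := mem_hyperbolicBall.1 hzb
  have hsT := hsub ⟨hs.1.le, hs.2⟩
  set σ : ℝ → ℝ := fun t => ε * Real.exp (K * t) with hσ
  have hσ0 : ∀ t, 0 < σ t := fun t => by positivity
  have hσmono : ∀ {a b}, a ≤ b → σ a ≤ σ b := fun h => by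
    simp only [hσ]
    gcongr
  have hσs : σ s ≤ 1 / 4 := (hσmono hs.2).trans hετ
  have hεσ : ε ≤ σ s := by simpa [hσ] using hσmono hs.1.le
  have hA : ∀ t, 0 ≤ t → 1 ≤ (m : ℝ) * (m - 1) * t + 1 := fun t ht => by
    have : 0 ≤ (m : ℝ) * (m - 1) * t := by positivity
    linarith
  have hfpos := hf.pos s hsT z hzb
  -- As `f > 0`, touching happens where the barrier is positive, hence smooth, and in the interior
  -- of `S`.
  have hzσ : σ s < 1 - ‖z‖ ^ 2 := by
    by_contra! h
    have h0 : max (1 - ‖z‖ ^ 2 - ε * Real.exp (K * s)) 0 = 0 := max_eq_right (sub_nonpos.2 h)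
    rw [h0] at hsz
    simp at hsz
    linarith
  have hevent : ∀ᶠ y in 𝓝 z, σ s < 1 - ‖y‖ ^ 2 :=
    (show Continuous fun y : EuclideanSpace ℝ (Fin m) => 1 - ‖y‖ ^ 2 by fun_prop).continuousAt
      |>.eventually_const_lt hzσ
  have hmax : ∀ {t} {y : EuclideanSpace ℝ (Fin m)}, t ≤ s → σ s < 1 - ‖y‖ ^ 2 →
      max (1 - ‖y‖ ^ 2 - ε * Real.exp (K * t)) 0 = 1 - ‖y‖ ^ 2 - σ t := fun ht hy =>
    max_eq_left (sub_nonneg.2 ((hσmono ht).trans hy.le))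
  set y := 1 - ‖z‖ ^ 2 with hy
  have hv : 4 * (m * (m - 1) * s + 1) * (y - σ s) ^ (n + 1) / y ^ (n + 3) = f s z := by
    rw [hmax le_rfl hzσ] at hsz
    linarith
  have hop := yamabeOperator_le_of_touching (by lia : 1 ≤ m)
    (f := fun y : EuclideanSpace ℝ (Fin m) => 4 * (m * (m - 1) * s + 1)
      * (1 - ‖y‖ ^ 2 - σ s) ^ (n + 1) / (1 - ‖y‖ ^ 2) ^ (n + 3))
    (ContDiffAt.div (contDiffAt_const.mul (((contDiffAt_const.sub
      (contDiff_norm_sq ℝ).contDiffAt).sub contDiffAt_const).pow _))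
      ((contDiffAt_const.sub (contDiff_norm_sq ℝ).contDiffAt).pow _) (pow_ne_zero _ hypos.ne'))
    ((hf.contDiffOn s hsT).contDiffAt (isOpen_hyperbolicBall.mem_nhds hzb))
    (by
      filter_upwards [hevent] with y hy
      have := hle y (hεσ.trans hy.le)
      rw [hmax le_rfl hy] at this
      linarith)
    hv (hv.symm ▸ hfpos)
  have hAs := hA s hs.1.le
  rw [yamabeOperator_lower_barrier (by linarith) (hσ0 s).le hzσ] at hop
  have hderiv : HasDerivWithinAt (fun t => 4 * (m * (m - 1) * t + 1) * (y - σ t) ^ (n + 1)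
      / y ^ (n + 3) - f t z)
      (4 * (m * (m - 1) * (y - σ s) ^ (n + 1)
        - (m * (m - 1) * s + 1) * ((n + 1) * (y - σ s) ^ n * (K * σ s))) / y ^ (n + 3)
        - yamabeOperator (f s) z) (timeInterval T) s := by
    refine HasDerivWithinAt.fun_sub (HasDerivAt.hasDerivWithinAt ?_) (hf.evolution s hsT z hzb)
    have hσ' : HasDerivAt (fun t => y - σ t) (-(K * σ s)) s := by
      refine ((((hasDerivAt_id s).const_mul K).exp.const_mul ε).const_sub y).congr_deriv ?_
      simp [hσ]
      ring
    have hA' : HasDerivAt (fun t : ℝ => 4 * ((m : ℝ) * (m - 1) * t + 1)) (4 * (m * (m - 1))) s := by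
      simpa using (((hasDerivAt_id s).const_mul ((m : ℝ) * (m - 1))).add_const 1).const_mul 4
    refine ((hA'.mul (hσ'.pow (n + 1))).div_const _).congr_deriv ?_
    simp
    ring
  have hnn := nonneg_of_hasDerivWithinAt_of_forall_le hs.1 (Icc_subset_timeInterval hsT) hderiv
    fun t ht => by
      have := hlt t ht
      rw [hmax ht.2.le hzσ] at this
      rw [hv, sub_self]
      exact this.le
  have hyne := hypos.ne'
  -- In terms of `w` and `y`, both the time derivative and the operator acquire the common factor `4
  -- (m - 1) / y²`.
  set w := σ s / y with hw
  have hσw : σ s = w * y := (div_mul_cancel₀ _ hyne).symm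
  have hw0 : 0 < w := div_pos (hσ0 s) hypos
  have hw1 : w < 1 := (div_lt_one hypos).2 hzσ
  have hw1' : (1 : ℝ) - w ≠ 0 := by linarith
  have hkey := lower_barrier_inequality (n := n) hm' hAs hJ hw0 hw1 hypos
    (by rw [hy]; nlinarith [sq_nonneg ‖z‖]) (hσw ▸ hσs)
  have hfac : y - σ s = y * (1 - w) := by rw [hσw]; ring
  have hz2 : ‖z‖ ^ 2 = 1 - y := by rw [hy]; ring
  rw [← hy, hfac, hz2] at hop
  rw [hfac, hσw, hK] at hnn
  have hpos : 0 < 4 * ((m : ℝ) - 1) / y ^ 2 := by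
    have : 0 < (m : ℝ) - 1 := by linarith
    positivity
  have h1 : 4 * (m * (m - 1) * (y * (1 - w)) ^ (n + 1)
        - (m * (m - 1) * s + 1) * ((n + 1) * (y * (1 - w)) ^ n
          * (m * (m - 1) * 2 ^ (n + 1) * (w * y)))) / y ^ (n + 3)
      = 4 * ((m : ℝ) - 1) / y ^ 2 * (m * (1 - w) ^ (n + 1)
        - m * (m * (m - 1) * s + 1) * (n + 1) * 2 ^ (n + 1) * w * (1 - w) ^ n) := by
    rw [mul_pow, mul_pow]
    field_simp
    ring
  have h2 : ((m : ℝ) - 1) * (4 * (1 - y) * (-(n + 1) / (y * (1 - w)) ^ 2 + (n + 3) / y ^ 2)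
        + 2 * m * (-(n + 1) / (y * (1 - w)) + (n + 3) / y)
        + ((m : ℝ) - 2) * (1 - y) * (-(n + 1) / (y * (1 - w)) + (n + 3) / y) ^ 2)
      = 4 * ((m : ℝ) - 1) / y ^ 2 * (m - m * (n + 1) / 2 * (2 - y) * (w / (1 - w))
        + (1 - y) * ((n + 1) * ((m - 2) * (n + 1) / 4 - 1)) * (w / (1 - w)) ^ 2) := by
    field_simp
    ring
  rw [h1] at hnn
  rw [h2] at hop
  have := mul_lt_mul_of_pos_left hkey hpos
  linarith

/-- With `τ` and `x` fixed, the conditions on `ε` hold for all small `ε > 0`, and the barrier tends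
to the expected value as `ε → 0`. -/
theorem IsConformalYamabeFlow.hyperbolic_le (hm : 3 ≤ m) {T : EReal}
    {f : ℝ → EuclideanSpace ℝ (Fin m) → ℝ} (hf : IsConformalYamabeFlow m T f) {τ : ℝ}
    (hτ : τ ∈ timeInterval T) {x : EuclideanSpace ℝ (Fin m)} (hx : x ∈ hyperbolicBall m) :
    (m * (m - 1) * τ + 1) * (4 / (1 - ‖x‖ ^ 2) ^ 2) ≤ f τ x := by
  have hxpos := mem_hyperbolicBall.1 hx
  set K : ℝ := m * (m - 1) * 2 ^ (8 * m + 4) with hK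
  have hl : Tendsto (fun ε : ℝ => 4 * ((m : ℝ) * (m - 1) * τ + 1)
      * (max (1 - ‖x‖ ^ 2 - ε * Real.exp (K * τ)) 0) ^ (8 * m + 4)
      / (1 - ‖x‖ ^ 2) ^ (8 * m + 6)) (𝓝[>] 0)
      (𝓝 ((m * (m - 1) * τ + 1) * (4 / (1 - ‖x‖ ^ 2) ^ 2))) := by
    have hc : Continuous (fun ε : ℝ => 4 * ((m : ℝ) * (m - 1) * τ + 1)
      * (max (1 - ‖x‖ ^ 2 - ε * Real.exp (K * τ)) 0) ^ (8 * m + 4)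
      / (1 - ‖x‖ ^ 2) ^ (8 * m + 6)) := by fun_prop
    have h := (hc.tendsto 0).mono_left (nhdsWithin_le_nhds (s := Set.Ioi 0))
    rw [zero_mul, sub_zero, max_eq_left hxpos.le] at h
    convert h using 2
    rw [show 8 * m + 6 = (8 * m + 4) + 2 from rfl, pow_add]
    field_simp
    ring
  refine le_of_tendsto hl ?_
  have h1 : ∀ᶠ ε : ℝ in 𝓝[>] 0, ε < 1 - ‖x‖ ^ 2 :=
    (eventually_lt_nhds hxpos).filter_mono nhdsWithin_le_nhds
  have h2 : ∀ᶠ ε : ℝ in 𝓝[>] 0, ε * Real.exp (K * τ) < 1 / 4 := by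
    have hc : ContinuousAt (fun ε : ℝ => ε * Real.exp (K * τ)) 0 := by fun_prop
    exact (hc.eventually_lt_const (by simp)).filter_mono nhdsWithin_le_nhds
  filter_upwards [h1, h2, self_mem_nhdsWithin] with ε hε1 hε2 hε0
  exact hf.lower_barrier_le hm hτ hε0 hK hε2.le hε1.le

end LowerBarrier

/-! ### Reduction to the conformal factor, and the converse. -/

section Rigidity

variable {m : ℕ}

theorem hyperbolicMetric_apply (x : EuclideanSpace ℝ (Fin m)) (i j : Fin m) :
    hyperbolicMetric m x i j = 4 / (1 - ‖x‖ ^ 2) ^ 2 * (1 : Matrix (Fin m) (Fin m) ℝ) i j := rfl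

/-- A Yamabe flow stays in the conformal class of its initial metric. -/
theorem IsYamabeFlow.eq_smul_one {T : EReal} {g : ℝ → TensorField m}
    (hg : IsYamabeFlow (hyperbolicBall m) (hyperbolicMetric m) T g) (i₀ : Fin m) {t : ℝ}
    (ht : t ∈ timeInterval T) {x : EuclideanSpace ℝ (Fin m)} (hx : x ∈ hyperbolicBall m) :
    g t x = g t x i₀ i₀ • (1 : Matrix (Fin m) (Fin m) ℝ) := by
  have hsub : Set.Icc 0 t ⊆ timeInterval T := Icc_subset_timeInterval ht
  have hpos : ∀ s ∈ timeInterval T, 0 < g s x i₀ i₀ := fun s hs => (hg.posDef s hs x hx).diag_pos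
  have hxpos := mem_hyperbolicBall.1 hx
  ext i j
  -- All components at `x` solve the same linear equation `u' = -R u`, so their ratios are constant.
  have hderiv : ∀ s ∈ Set.Icc 0 t,
      HasDerivWithinAt (fun s => g s x i j / g s x i₀ i₀) 0 (Set.Icc 0 t) s := fun s hs => by
    have hs' := hsub hs
    refine (((hg.evolution s hs' x hx i j).mono hsub).div
      ((hg.evolution s hs' x hx i₀ i₀).mono hsub) (hpos s hs').ne').congr_deriv ?_
    rw [div_eq_zero_iff]
    left
    ring
  have hconst := constant_of_derivWithin_zero (fun s hs => (hderiv s hs).differentiableWithinAt)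
    (fun s hs => (hderiv s ⟨hs.1, hs.2.le⟩).derivWithin
      (uniqueDiffOn_Icc (hs.1.trans_lt hs.2) s ⟨hs.1, hs.2.le⟩)) t ⟨ht.1, le_rfl⟩
  simp only [hg.initial x hx, hyperbolicMetric_apply, Matrix.one_apply_eq, mul_one] at hconst
  rw [div_eq_iff (hpos t ht).ne', mul_div_cancel_left₀ _ (by positivity)] at hconst
  rw [hconst, Matrix.smul_apply, smul_eq_mul, mul_comm]

theorem IsYamabeFlow.isConformalYamabeFlow {T : EReal} {g : ℝ → TensorField m}
    (hg : IsYamabeFlow (hyperbolicBall m) (hyperbolicMetric m) T g) (i₀ : Fin m) :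
    IsConformalYamabeFlow m T fun t x => g t x i₀ i₀ where
  pos t ht x hx := (hg.posDef t ht x hx).diag_pos
  contDiffOn t ht := hg.contDiffOn t ht i₀ i₀
  continuousOn := hg.continuousOn i₀ i₀
  evolution t ht x hx := by
    have hnhds := isOpen_hyperbolicBall.mem_nhds hx
    rw [← scalarCurvature_conformal (g := g t) ?_ ((hg.contDiffOn t ht i₀ i₀).contDiffAt hnhds)
      (hg.posDef t ht x hx).diag_pos.ne']
    · exact hg.evolution t ht x hx i₀ i₀
    · filter_upwards [hnhds] with y hy using hg.eq_smul_one i₀ ht hy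
  initial x hx := by
    simp only [hg.initial x hx, hyperbolicMetric_apply, Matrix.one_apply_eq, mul_one]

theorem continuousOn_of_eq_mul {X : Type*} [TopologicalSpace X] {I : Set ℝ} {U : Set X}
    {F : ℝ × X → ℝ} {a : ℝ → ℝ} {b : X → ℝ} (ha : Continuous a) (hb : ContinuousOn b U)
    (h : ∀ t ∈ I, ∀ x ∈ U, F (t, x) = b x * a t) : ContinuousOn F (I ×ˢ U) :=
  ((hb.comp continuousOn_snd fun _ hp => hp.2).mul (ha.comp continuous_fst).continuousOn).congr
    fun p hp => h p.1 hp.1 p.2 hp.2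

/-- The expanding hyperbolic metric is a Yamabe flow. -/
theorem isYamabeFlow_hyperbolic (hm : 1 ≤ m) {T : EReal} {g : ℝ → TensorField m} (hT : 0 < T)
    (hg : ∀ t ∈ timeInterval T, ∀ x ∈ hyperbolicBall m,
      g t x = ((m : ℝ) * ((m : ℝ) - 1) * t + 1) • hyperbolicMetric m x) :
    IsYamabeFlow (hyperbolicBall m) (hyperbolicMetric m) T g := by
  have hm' : (1 : ℝ) ≤ m := by exact_mod_cast hm
  set a : ℝ → ℝ := fun t => (m : ℝ) * ((m : ℝ) - 1) * t + 1 with ha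
  have hapos : ∀ t ∈ timeInterval T, 0 < a t := fun t ht => by
    have := mul_nonneg (mul_nonneg (by linarith : (0 : ℝ) ≤ m) (sub_nonneg.2 hm')) ht.1
    simp only [ha]
    linarith
  have hac : Continuous a := by fun_prop
  set b : Fin m → Fin m → EuclideanSpace ℝ (Fin m) → ℝ := fun i j x => hyperbolicMetric m x i j
  have hb : ∀ i j, ∀ x ∈ hyperbolicBall m, ContDiffAt ℝ 2 (b i j) x := fun i j x hx =>
    (contDiffAt_hyperbolic (sub_pos.1 (mem_hyperbolicBall.1 hx))).mul contDiffAt_const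
  have hbd : ∀ i j, ∀ x ∈ hyperbolicBall m, DifferentiableAt ℝ (b i j) x := fun i j x hx =>
    (hb i j x hx).differentiableAt (by norm_num)
  have hbk : ∀ i j k, ∀ x ∈ hyperbolicBall m, ContDiffAt ℝ 1 (partialDeriv k (b i j)) x :=
    fun i j k x hx => contDiffAt_partialDeriv k (hb i j x hx)
  have hbkd : ∀ i j k, ∀ x ∈ hyperbolicBall m, DifferentiableAt ℝ (partialDeriv k (b i j)) x :=
    fun i j k x hx => (hbk i j k x hx).differentiableAt (by norm_num)
  have hgb : ∀ t ∈ timeInterval T, ∀ i j, ∀ x ∈ hyperbolicBall m, g t x i j = b i j x * a t :=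
    fun t ht i j x hx => by
      rw [hg t ht x hx, Matrix.smul_apply, smul_eq_mul, mul_comm]
  have hev : ∀ t ∈ timeInterval T, ∀ i j, ∀ x ∈ hyperbolicBall m,
      (fun y => g t y i j) =ᶠ[𝓝 x] fun y => b i j y * a t := fun t ht i j x hx => by
    filter_upwards [isOpen_hyperbolicBall.mem_nhds hx] with y hy using hgb t ht i j y hy
  have hp : ∀ t ∈ timeInterval T, ∀ i j k, ∀ x ∈ hyperbolicBall m,
      partialDeriv k (fun y => g t y i j) x = partialDeriv k (b i j) x * a t :=
    fun t ht i j k x hx => by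
      rw [(partialDeriv_congr k (hev t ht i j x hx)).eq_of_nhds,
        partialDeriv_mul_const k (hbd i j x hx)]
  have hpp : ∀ t ∈ timeInterval T, ∀ i j k l, ∀ x ∈ hyperbolicBall m,
      partialDeriv l (partialDeriv k (fun y => g t y i j)) x
        = partialDeriv l (partialDeriv k (b i j)) x * a t := fun t ht i j k l x hx => by
    have : partialDeriv k (fun y => g t y i j) =ᶠ[𝓝 x] fun y => partialDeriv k (b i j) y * a t := by
      filter_upwards [isOpen_hyperbolicBall.mem_nhds hx] with y hy using hp t ht i j k y hy
    rw [(partialDeriv_congr l this).eq_of_nhds, partialDeriv_mul_const l (hbkd i j k x hx)]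
  refine ⟨fun t ht x hx => ?_, fun t ht i j x hx => ?_, fun i j => ?_, fun i j k => ?_,
    fun i j k l => ?_, fun t ht x hx i j => ?_, fun x hx => ?_⟩
  · have hxpos := mem_hyperbolicBall.1 hx
    rw [hg t ht x hx, hyperbolicMetric, smul_smul]
    exact Matrix.PosDef.one.smul (mul_pos (hapos t ht) (by positivity))
  · exact (((hb i j x hx).mul contDiffAt_const).congr_of_eventuallyEq
      (hev t ht i j x hx)).contDiffWithinAt
  · exact continuousOn_of_eq_mul hac (fun x hx => (hbd i j x hx).continuousAt.continuousWithinAt)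
      fun t ht x hx => hgb t ht i j x hx
  · exact continuousOn_of_eq_mul hac
      (fun x hx => (hbkd i j k x hx).continuousAt.continuousWithinAt)
      fun t ht x hx => hp t ht i j k x hx
  · refine continuousOn_of_eq_mul hac (fun x hx => ContinuousAt.continuousWithinAt ?_)
      fun t ht x hx => hpp t ht i j k l x hx
    exact (((hbk i j k x hx).fderiv_right (m := 0) (by norm_num)).clm_apply
      contDiffAt_const).continuousAt
  · have hxpos := mem_hyperbolicBall.1 hx
    have hx1 : ‖x‖ ^ 2 < 1 := sub_pos.1 hxpos
    have hconf : g t =ᶠ[𝓝 x] fun y =>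
        (4 * a t / (1 - ‖y‖ ^ 2) ^ 2) • (1 : Matrix (Fin m) (Fin m) ℝ) := by
      filter_upwards [isOpen_hyperbolicBall.mem_nhds hx] with y hy
      rw [hg t ht y hy, hyperbolicMetric, smul_smul]
      congr 1
      simp only [ha]
      ring
    have hat := hapos t ht
    have hR := scalarCurvature_conformal hconf (contDiffAt_hyperbolic hx1) (by positivity)
    -- The operator does not see the factor `a t`, which is why `a` grows linearly, at rate `m(m -
    -- 1)`.
    rw [yamabeOperator_hyperbolic (by positivity) hx1] at hR
    have hderiv : HasDerivAt (fun s => b i j x * a s) (b i j x * (m * (m - 1))) t := by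
      simpa using (((hasDerivAt_id t).const_mul ((m : ℝ) * (m - 1))).add_const 1).const_mul
        (b i j x)
    refine (hderiv.hasDerivWithinAt.congr (fun s hs => hgb s hs i j x hx)
      (hgb t ht i j x hx)).congr_deriv ?_
    have hsplit : -scalarCurvature (g t) x * g t x i j
        = -scalarCurvature (g t) x * (4 * a t / (1 - ‖x‖ ^ 2) ^ 2)
          * (1 : Matrix (Fin m) (Fin m) ℝ) i j := by
      rw [hconf.eq_of_nhds, Matrix.smul_apply, smul_eq_mul, mul_assoc]
    rw [hsplit, hR]
    simp only [b, hyperbolicMetric_apply]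
    ring
  · have h0 : (0 : ℝ) ∈ timeInterval T := ⟨le_rfl, by exact_mod_cast hT⟩
    simp [hg 0 h0 x hx]

end Rigidity

theorem theorem2 (m : ℕ) (hm : 3 ≤ m) (T : EReal) (hT : 0 < T) (g : ℝ → TensorField m) :
    IsYamabeFlow (hyperbolicBall m) (hyperbolicMetric m) T g ↔
      ∀ t ∈ timeInterval T, ∀ x ∈ hyperbolicBall m,
        g t x = ((m : ℝ) * ((m : ℝ) - 1) * t + 1) • hyperbolicMetric m x := by
  refine ⟨fun hg t ht x hx => ?_, isYamabeFlow_hyperbolic (by lia) hT⟩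
  have hf := hg.isConformalYamabeFlow (⟨0, by lia⟩ : Fin m)
  rw [hg.eq_smul_one ⟨0, by lia⟩ ht hx, hyperbolicMetric, smul_smul]
  congr 1
  exact le_antisymm (hf.le_hyperbolic (by lia) ht hx) (hf.hyperbolic_le hm ht hx)
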